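/- A twofold triple system TTS($v$) consists of a set of $v$ points and a finite collection of blocks (repeated blocks allowed), each block being a 3-subset of the point set, such that each pair of distinct points is contained in exactly two blocks. Its 2-block-intersection graph (2-BIG) is the graph whose vertices are the blocks, two different blocks $B_1, B_2$ being adjacent if and only if $|B_1 \cap B_2| = 2$. A graph is Hamiltonian if it has a Hamilton cycle. **Theorem.** Let $v \geq 4$ be an integer. If there exists a TTS($v$) whose 2-BIG is Hamiltonian, then there exists a TTS($3v$) whose 2-BIG is Hamiltonian. -/

import Mathlib

/-- A balanced incomplete block design BIBD(`v`, `k`, `l`): `v` points, every block is a set of `k`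
points, and every pair of distinct points lies in exactly `l` blocks. The blocks are an indexed
family of sets of points, so that repeated blocks are allowed and are counted with multiplicity. -/
structure BIBD (v k l : ℕ) where
  /-- the points -/
  Point : Type
  /-- the (indices of the) blocks -/
  Block : Type
  [fintypePoint : Fintype Point]
  [decidableEqPoint : DecidableEq Point]
  [fintypeBlock : Fintype Block]
  [decidableEqBlock : DecidableEq Block]
  /-- the set of points of a block -/
  pts : Block → Finset Point
  card_point : Fintype.card Point = v
  card_pts : ∀ B : Block, (pts B).card = k
  card_pair : ∀ x y : Point, x ≠ y →
    (Finset.univ.filter fun B : Block => x ∈ pts B ∧ y ∈ pts B).card = l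

attribute [instance] BIBD.fintypePoint BIBD.decidableEqPoint BIBD.fintypeBlock
  BIBD.decidableEqBlock

/-- A twofold triple system TTS(`v`). -/
abbrev TTS (v : ℕ) := BIBD v 3 2

/-- The `i`-block-intersection graph: its vertices are the blocks, and two different blocks (possibly
two copies of the same set of points) are adjacent if and only if they share exactly `i` points. -/
def BIBD.iBIG {v k l : ℕ} (D : BIBD v k l) (i : ℕ) : SimpleGraph D.Block where
  Adj B₁ B₂ := B₁ ≠ B₂ ∧ (D.pts B₁ ∩ D.pts B₂).card = i
  symm := ⟨fun _ _ h => ⟨h.1.symm, by rw [Finset.inter_comm]; exact h.2⟩⟩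
  loopless := ⟨fun _ h => h.1 rfl⟩

/-! Three disjoint copies of the given system, on the groups `{i} × ZMod v`, together with the
transversal triples of the Latin squares `r + c` and `r + c + 1`, form a TTS(3v). Its 2-BIG is
disconnected: a transversal triple meets a block of a copy in at most one point. Two trades repair
this. A trade interchanges two points inside a few blocks; if both points occur there equally often
with every third point, all pair counts survive (`PairBalanced.swapPts`). The traded blocks act as
bridges between the copies and the transversal triples.

Deleting a block `X = {a, b, c}` from the given Hamilton cycle leaves a path whose ends contain `{a,
b}` and `{a, c}` (`BIBD.exists_path_of_isHamiltonian`). Each copy is labelled so that its `X` lies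
in a trade and both ends of its path share a pair with a block changed or used by the trades. Among
the transversal triples, the two triples of a cell share row and column, and a high triple shares
row and symbol with the low triple in the next column. Hence rows are traversed in zigzag, and
column 0 leads from one row to the next. `tradedCycle` splices these rows, the three paths and the
bridges; `pathFromTo_tradedCycle` checks its adjacencies. It meets every block and is as long as the
number of blocks, so it is a Hamilton cycle. -/

open Finset

/-! ### Paths as lists, and Hamilton cycles from them -/

/-- The list `l` runs from `a` to `b`, with consecutive entries related by `R`. -/
structure PathFromTo {V : Type*} (R : V → V → Prop) (l : List V) (a b : V) : Prop where
  isChain : l.IsChain R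
  head : l.head? = some a
  last : l.getLast? = some b

namespace PathFromTo

variable {V : Type*} {R : V → V → Prop} {l l' : List V} {a b c d : V}

theorem singleton (a : V) : PathFromTo R [a] a a := ⟨by simp, rfl, rfl⟩

theorem append (h : PathFromTo R l a b) (hbc : R b c) (h' : PathFromTo R l' c d) :
    PathFromTo R (l ++ l') a d where
  isChain := by
    refine List.isChain_append.2 ⟨h.isChain, h'.isChain, fun x hx y hy => ?_⟩
    rw [h.last, Option.mem_some_iff] at hx
    rw [h'.head, Option.mem_some_iff] at hy
    rwa [← hx, ← hy]
  head := by simp [List.head?_append, h.head]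
  last := by simp [List.getLast?_append, h'.last]

theorem cons (hab : R a b) (h : PathFromTo R l b c) : PathFromTo R (a :: l) a c :=
  (singleton a).append hab h

theorem concat (h : PathFromTo R l a b) (hbc : R b c) : PathFromTo R (l ++ [c]) a c :=
  h.append hbc (singleton c)

theorem reverse (hR : ∀ x y, R x y → R y x) (h : PathFromTo R l a b) :
    PathFromTo R l.reverse b a where
  isChain := List.isChain_reverse.2 (h.isChain.imp hR)
  head := by rw [List.head?_reverse, h.last]
  last := by rw [List.getLast?_reverse, h.head]

end PathFromTo

namespace SimpleGraph

/-- A cyclic list of vertices with consecutive entries adjacent that meets every vertex and is no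
longer than the number of vertices is a Hamilton cycle. -/
theorem isHamiltonian_of_pathFromTo {V : Type*} [Fintype V] [DecidableEq V] {G : SimpleGraph V}
    {l : List V} {a b : V} (hpath : PathFromTo G.Adj l a b) (hba : G.Adj b a) (hmem : ∀ w, w ∈ l)
    (hlen : l.length = Fintype.card V) (hcard : 3 ≤ l.length) : G.IsHamiltonian := by
  intro _
  have hne : l ≠ [] := List.length_pos_iff.1 (by omega)
  have hclose : G.Adj (l.getLast hne) (l.head hne) := by
    have h1 := hpath.head
    have h2 := hpath.last
    rw [List.head?_eq_some_head hne, Option.some_inj] at h1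
    rw [List.getLast?_eq_some_getLast hne, Option.some_inj] at h2
    rwa [h1, h2]
  have hchain := hpath.isChain
  -- A list that covers all vertices and is no longer than their number cannot repeat one.
  have hnodup : l.Nodup := by
    have h1 : l.toFinset = univ := by ext w; simp [hmem w]
    have h2 := congrArg Finset.card h1
    rw [Finset.card_univ, ← hlen] at h2
    exact Multiset.toFinset_card_eq_card_iff_nodup.1 h2
  let p := Walk.ofSupport l hne hchain
  have hp : p.IsPath := Walk.IsPath.mk' (by simpa [p] using hnodup)
  have hl : p.length = l.length - 1 := Walk.length_ofSupport hne hchain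
  refine ⟨_, Walk.cons hclose p, ?_⟩
  refine Walk.isHamiltonianCycle_iff_isCycle_and_length_eq.2 ⟨?_, ?_⟩
  -- The closing edge could already lie on the path only if the path had length one, which three
  -- entries exclude.
  · refine (Walk.cons_isCycle_iff p hclose).2 ⟨hp, fun he => ?_⟩
    have := hp.length_eq_one_of_mem_edges (by rwa [Sym2.eq_swap])
    omega
  · rw [Walk.length_cons, hl]
    omega

end SimpleGraph

/-! ### Blocks meeting in two points, and trades -/

section Triples

variable {α β : Type*} [DecidableEq α] {l : ℕ}

/-- Two different blocks meet in exactly two points. -/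
def MeetInTwo (pts : β → Finset α) (B C : β) : Prop := B ≠ C ∧ #(pts B ∩ pts C) = 2

theorem MeetInTwo.symm {pts : β → Finset α} {B C : β} (h : MeetInTwo pts B C) :
    MeetInTwo pts C B := ⟨h.1.symm, by rw [inter_comm]; exact h.2⟩

/-- The point `z` of `B` outside `C` both separates the two blocks and bounds the intersection by
two, so adjacency reduces to membership tests and nothing about the size of `C` is needed. -/
theorem meetInTwo_of_mem {pts : β → Finset α} {B C : β} {x y : α} (z : α) (hB : #(pts B) = 3)
    (hxy : x ≠ y) (hxB : x ∈ pts B) (hyB : y ∈ pts B) (hxC : x ∈ pts C) (hyC : y ∈ pts C)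
    (hzB : z ∈ pts B) (hzC : z ∉ pts C) : MeetInTwo pts B C := by
  refine ⟨fun h => hzC (h ▸ hzB), le_antisymm ?_ ?_⟩
  · have h1 : pts B ∩ pts C ⊂ pts B :=
      ⟨inter_subset_left, fun h => hzC (mem_inter.1 (h hzB)).2⟩
    have := card_lt_card h1
    omega
  · have h1 : ({x, y} : Finset α) ⊆ pts B ∩ pts C := by
      intro w hw
      rcases mem_insert.1 hw with rfl | hw
      · exact mem_inter.2 ⟨hxB, hxC⟩
      · rw [mem_singleton.1 hw]
        exact mem_inter.2 ⟨hyB, hyC⟩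
    rw [← Finset.card_pair hxy]
    exact card_le_card h1

variable [DecidableEq β]

/-- Every pair of distinct points lies in exactly `l` blocks. -/
def PairBalanced [Fintype β] (pts : β → Finset α) (l : ℕ) : Prop :=
  ∀ x y, x ≠ y → #{B | x ∈ pts B ∧ y ∈ pts B} = l

/-- Interchange the points `x` and `y` in all blocks of `S`. -/
def swapPts (pts : β → Finset α) (x y : α) (S : Finset β) (B : β) : Finset α :=
  if B ∈ S then (pts B).map (Equiv.swap x y).toEmbedding else pts B

theorem card_swapPts (pts : β → Finset α) (x y : α) (S : Finset β) (B : β) :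
    #(swapPts pts x y S B) = #(pts B) := by
  unfold swapPts
  split_ifs <;> simp

/-- Interchanging two points in all blocks of a set `S` keeps a design balanced, provided that in
`S` the two points occur equally often with every third point. -/
theorem PairBalanced.swapPts [Fintype β] {pts : β → Finset α} (hD : PairBalanced pts l) (x y : α)
    (S : Finset β) (h : ∀ z, z ≠ x → z ≠ y →
      ∑ B ∈ S, (if x ∈ pts B ∧ z ∈ pts B then 1 else 0) =
        ∑ B ∈ S, (if y ∈ pts B ∧ z ∈ pts B then 1 else 0)) :
    PairBalanced (swapPts pts x y S) l := by
  intro p q hpq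
  refine Eq.trans ?_ (hD p q hpq)
  rw [card_filter, card_filter, ← sum_add_sum_compl S,
    ← sum_add_sum_compl S (fun B => if p ∈ pts B ∧ q ∈ pts B then 1 else 0)]
  unfold _root_.swapPts
  congr 1
  · have hmem : ∀ (B : β) (z : α),
        z ∈ (pts B).map (Equiv.swap x y).toEmbedding ↔ Equiv.swap x y z ∈ pts B := by
      intro B z
      rw [mem_map_equiv, Equiv.symm_swap]
    -- Pairs avoiding both points, or equal to `{x, y}`, are preserved by the interchange; the
    -- hypothesis settles pairs containing exactly one of them.
    have key : ∑ B ∈ S,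
        (if Equiv.swap x y p ∈ pts B ∧ Equiv.swap x y q ∈ pts B then 1 else 0) =
          ∑ B ∈ S, (if p ∈ pts B ∧ q ∈ pts B then 1 else 0) := by
      by_cases hpx : p = x
      · subst hpx
        rw [Equiv.swap_apply_left]
        by_cases hqy : q = y
        · subst hqy
          simp only [Equiv.swap_apply_right, and_comm]
        · rw [Equiv.swap_apply_of_ne_of_ne hpq.symm hqy, h q hpq.symm hqy]
      by_cases hpy : p = y
      · subst hpy
        rw [Equiv.swap_apply_right]
        by_cases hqx : q = x
        · subst hqx
          simp only [Equiv.swap_apply_left, and_comm]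
        · rw [Equiv.swap_apply_of_ne_of_ne hqx hpq.symm, h q hqx hpq.symm]
      rw [Equiv.swap_apply_of_ne_of_ne hpx hpy]
      simp only [and_comm (a := p ∈ _)]
      by_cases hqx : q = x
      · subst hqx
        rw [Equiv.swap_apply_left, h p hpx hpy]
      by_cases hqy : q = y
      · subst hqy
        rw [Equiv.swap_apply_right, h p hpx hpy]
      rw [Equiv.swap_apply_of_ne_of_ne hqx hqy]
    rw [← key]
    refine sum_congr rfl fun B hB => ?_
    simp only [hB, if_true, hmem]
  · refine sum_congr rfl fun B hB => ?_
    simp only [mem_compl.1 hB, if_false]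

end Triples

/-! ### Cutting the given Hamilton cycle at a block -/

namespace BIBD

variable {v : ℕ}

/-- A Hamilton cycle of the 2-block-intersection graph of a TTS, cut open at a block `X`: the other
blocks form a path, and the ends of the path meet `X` in two different pairs of points. -/
theorem exists_path_of_isHamiltonian (D : TTS v) (hv : 4 ≤ v) (h : (D.iBIG 2).IsHamiltonian) :
    ∃ (X P Q : D.Block) (t : List D.Block) (a b c : D.Point),
      a ≠ b ∧ a ≠ c ∧ b ≠ c ∧ D.pts X = {a, b, c} ∧
      PathFromTo (D.iBIG 2).Adj t P Q ∧
      (∀ B, B ≠ X ↔ B ∈ t) ∧ t.length + 1 = Fintype.card D.Block ∧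
      (a ∈ D.pts P ∧ b ∈ D.pts P) ∧ a ∈ D.pts Q ∧ c ∈ D.pts Q := by
  have hcard : Fintype.card D.Block ≠ 1 := by
    have hP : 1 < Fintype.card D.Point := by rw [D.card_point]; omega
    obtain ⟨x, y, hxy⟩ := Fintype.exists_pair_of_one_lt_card hP
    have := D.card_pair x y hxy
    have := card_le_univ (univ.filter fun B : D.Block => x ∈ D.pts B ∧ y ∈ D.pts B)
    omega
  obtain ⟨X, p, hp⟩ := h hcard
  have hcyc := hp.isCycle
  have hlen3 := hcyc.three_le_length
  have hlen := hp.length_eq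
  have hham :=
    (SimpleGraph.Walk.isHamiltonianCycle_iff_isCycle_and_support_count_tail_eq_one.1 hp).2
  obtain ⟨P, hXP, q, rfl⟩ := SimpleGraph.Walk.not_nil_iff.1 hcyc.not_nil
  have hq : q.IsHamiltonian := fun B => by simpa using hham B
  have hqlen : q.length = Fintype.card D.Block - 1 := hq.length_eq
  set t := q.support.dropLast with ht
  have hsupp : q.support = t ++ [X] := by
    rw [ht]
    conv_lhs => rw [← List.dropLast_append_getLast q.support_ne_nil]
    simp
  have hnd := hq.isPath.support_nodup
  have hchain := q.isChain_adj_support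
  rw [hsupp] at hnd hchain
  have htl : t.length = q.length := by simp [ht]
  have hne : t ≠ [] := by
    rw [← List.length_pos_iff]
    simp at hlen3
    omega
  have hhead : t.head hne = P := by
    have h1 : q.support.head q.support_ne_nil = P := by simp
    simp only [hsupp] at h1
    rwa [List.head_append_of_ne_nil hne] at h1
  have hlast : (D.iBIG 2).Adj (t.getLast hne) X := by
    rw [List.isChain_append] at hchain
    exact hchain.2.2 _ (List.getLast_mem_getLast? hne) X (by simp)
  -- A cycle has length at least three, so the path left after removing `X` has at least two
  -- vertices and distinct ends.
  have hPQ : P ≠ t.getLast hne := by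
    intro h
    rw [← hhead] at h
    have h2 : 2 ≤ t.length := by simp at hlen3; omega
    have htn : t.Nodup := (List.nodup_append.1 hnd).1
    rw [List.head_eq_getElem, List.getLast_eq_getElem, htn.getElem_inj_iff] at h
    omega
  set Q := t.getLast hne with hQ
  have hmem : ∀ B, B ≠ X ↔ B ∈ t := by
    intro B
    have h1 := hq.mem_support B
    rw [hsupp] at h1
    have h2 := (List.nodup_append.1 hnd).2.2
    constructor
    · intro h; simpa [h] using h1
    · intro h3; exact h2 B h3 X (by simp)
  have hXPc : (D.pts X ∩ D.pts P).card = 2 := hXP.2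
  have hXQc : (D.pts X ∩ D.pts Q).card = 2 := hlast.symm.2
  -- If both ends met `X` in the same pair, that pair would lie in the three blocks `X`, `P`, `Q`.
  have hdiff : D.pts X ∩ D.pts P ≠ D.pts X ∩ D.pts Q := by
    intro h
    obtain ⟨x, y, hxy, hxyP⟩ := card_eq_two.1 hXPc
    have hxyQ := h ▸ hxyP
    have hsub : ({X, P, Q} : Finset D.Block) ⊆
        univ.filter fun B : D.Block => x ∈ D.pts B ∧ y ∈ D.pts B := by
      have hx1 : x ∈ D.pts X ∩ D.pts P := by simp [hxyP]
      have hy1 : y ∈ D.pts X ∩ D.pts P := by simp [hxyP]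
      have hx2 : x ∈ D.pts X ∩ D.pts Q := by simp [hxyQ]
      have hy2 : y ∈ D.pts X ∩ D.pts Q := by simp [hxyQ]
      rw [mem_inter] at hx1 hy1 hx2 hy2
      intro B hB
      simp only [mem_insert, mem_singleton] at hB
      rw [mem_filter]
      rcases hB with hB | hB | hB <;> rw [hB]
      · exact ⟨mem_univ _, hx1.1, hy1.1⟩
      · exact ⟨mem_univ _, hx1.2, hy1.2⟩
      · exact ⟨mem_univ _, hx2.2, hy2.2⟩
    have h3 := card_le_card hsub
    rw [D.card_pair x y hxy, card_eq_three.2 ⟨X, P, Q, hXP.1, hlast.1.symm, hPQ, rfl⟩] at h3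
    omega
  obtain ⟨x, y, z, hxy, hxz, hyz, hX⟩ := card_eq_three.1 (D.card_pts X)
  have key : ∃ a b c : D.Point, a ≠ b ∧ a ≠ c ∧ b ≠ c ∧ D.pts X = {a, b, c} ∧
      (a ∈ D.pts P ∧ b ∈ D.pts P) ∧ a ∈ D.pts Q ∧ c ∈ D.pts Q := by
    have e1 : D.pts X = {x, z, y} := by rw [hX]; ext; simp; tauto
    have e2 : D.pts X = {y, x, z} := by rw [hX]; ext; simp; tauto
    have e3 : D.pts X = {y, z, x} := by rw [hX]; ext; simp; tauto
    have e4 : D.pts X = {z, x, y} := by rw [hX]; ext; simp; tauto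
    have e5 : D.pts X = {z, y, x} := by rw [hX]; ext; simp; tauto
    rw [hX] at hXPc hXQc hdiff
    -- Each end contains exactly one of the three pairs of `X`; the six ordered choices of different
    -- pairs are the six orderings of its points.
    by_cases h1 : x ∈ D.pts P <;> by_cases h2 : y ∈ D.pts P <;> by_cases h3 : z ∈ D.pts P <;>
      simp [insert_inter_of_mem, insert_inter_of_notMem, singleton_inter_of_mem,
        singleton_inter_of_notMem, h1, h2, h3, hxy, hxz, hyz] at hXPc <;>
    by_cases h4 : x ∈ D.pts Q <;> by_cases h5 : y ∈ D.pts Q <;> by_cases h6 : z ∈ D.pts Q <;>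
      simp [insert_inter_of_mem, insert_inter_of_notMem, singleton_inter_of_mem,
        singleton_inter_of_notMem, h1, h2, h3, h4, h5, h6, hxy, hxz, hyz] at hXQc hdiff <;>
    first
      | exact ⟨x, y, z, hxy, hxz, hyz, hX,
          ⟨by assumption, by assumption⟩, by assumption, by assumption⟩
      | exact ⟨x, z, y, hxz, hxy, hyz.symm, e1,
          ⟨by assumption, by assumption⟩, by assumption, by assumption⟩
      | exact ⟨y, x, z, hxy.symm, hyz, hxz, e2,
          ⟨by assumption, by assumption⟩, by assumption, by assumption⟩
      | exact ⟨y, z, x, hyz, hxy.symm, hxz.symm, e3,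
          ⟨by assumption, by assumption⟩, by assumption, by assumption⟩
      | exact ⟨z, x, y, hxz.symm, hyz.symm, hxy, e4,
          ⟨by assumption, by assumption⟩, by assumption, by assumption⟩
      | exact ⟨z, y, x, hyz.symm, hxz.symm, hxy.symm, e5,
          ⟨by assumption, by assumption⟩, by assumption, by assumption⟩
  obtain ⟨a, b, c, hab, hac, hbc, hXabc, hPabc, hQabc⟩ := key
  have hpos : 0 < Fintype.card D.Block := Fintype.card_pos_iff.2 ⟨X⟩
  exact ⟨X, P, Q, t, a, b, c, hab, hac, hbc, hXabc,
    ⟨(List.isChain_append.1 hchain).1, by rw [List.head?_eq_some_head hne, hhead],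
      by rw [List.getLast?_eq_some_getLast hne]⟩, hmem, by omega, hPabc, hQabc⟩

end BIBD

/-- Three distinct elements can be mapped to any three distinct elements by a bijection. -/
theorem exists_equiv_of_three {α β : Type*} [Fintype α] [Fintype β] [DecidableEq α]
    [DecidableEq β] (h : Fintype.card α = Fintype.card β) {a b c : α} {x y z : β} (hab : a ≠ b)
    (hac : a ≠ c) (hbc : b ≠ c) (hxy : x ≠ y) (hxz : x ≠ z) (hyz : y ≠ z) :
    ∃ e : α ≃ β, e a = x ∧ e b = y ∧ e c = z := by
  obtain ⟨e⟩ := Fintype.card_eq.1 h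
  let e₁ := e.trans (Equiv.swap (e a) x)
  have h1 : e₁ a = x := by simp [e₁]
  let e₂ := e₁.trans (Equiv.swap (e₁ b) y)
  have h2 : e₂ b = y := by simp [e₂]
  have h2a : e₂ a = x := by
    have : x ≠ e₁ b := fun h => hab (e₁.injective (h1.trans h))
    simp [e₂, h1, Equiv.swap_apply_of_ne_of_ne this hxy]
  refine ⟨e₂.trans (Equiv.swap (e₂ c) z), ?_, ?_, by simp⟩
  · have : x ≠ e₂ c := fun h => hac (e₂.injective (h2a.trans h))
    simp [h2a, Equiv.swap_apply_of_ne_of_ne this hxz]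
  · have : y ≠ e₂ c := fun h => hbc (e₂.injective (h2.trans h))
    simp [h2, Equiv.swap_apply_of_ne_of_ne this hyz]

/-! ### The tripled system before the trades -/

section Tripling

variable {v : ℕ}

/-- The blocks of a tripled system: three copies of the blocks of a system, and two blocks for each
cell of a Latin square. -/
abbrev TripleBlock (β : Type) (v : ℕ) := (Fin 3 × β) ⊕ (ZMod v × ZMod v × Bool)

/-- The points of the blocks in three copies of a system together with the transversal triples of
the Latin squares `r + c` and `r + c + 1`. -/
def triplePts {α β : Type} (pts : β → Finset α) (e : Fin 3 → α ≃ ZMod v) :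
    TripleBlock β v → Finset (Fin 3 × ZMod v)
  | .inl (i, B) => (pts B).map ((e i).toEmbedding.trans (Function.Embedding.sectR i (ZMod v)))
  | .inr (r, c, b) => {(0, r), (1, c), (2, r + c + if b then 1 else 0)}

variable {α β : Type} {pts : β → Finset α} {e : Fin 3 → α ≃ ZMod v}

theorem mem_triplePts_inl {i j : Fin 3} {B : β} {w : ZMod v} :
    (j, w) ∈ triplePts pts e (.inl (i, B)) ↔ j = i ∧ (e i).symm w ∈ pts B := by
  simp only [triplePts, mem_map, Function.Embedding.trans_apply, Equiv.coe_toEmbedding,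
    Function.Embedding.sectR_apply, Prod.mk.injEq]
  constructor
  · rintro ⟨a, ha, rfl, rfl⟩
    exact ⟨rfl, by simpa using ha⟩
  · rintro ⟨rfl, h⟩
    exact ⟨_, h, rfl, by simp⟩

theorem card_triplePts (h : ∀ B, #(pts B) = 3) (B : TripleBlock β v) :
    #(triplePts pts e B) = 3 := by
  rcases B with ⟨i, B⟩ | ⟨r, c, b⟩
  · simp [triplePts, h]
  · exact card_eq_three.2 ⟨_, _, _, by simp, by simp, by simp, rfl⟩

/-- A pair inside one group is covered only by its copy of the system. A pair across two groups
gives two of row, column and symbol, hence exactly one cell in each Latin square. -/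
theorem pairBalanced_triplePts [NeZero v] [DecidableEq α] [Fintype β] [DecidableEq β]
    (h : PairBalanced pts 2) : PairBalanced (triplePts pts e) 2 := by
  -- Here `f b` is the unique cell of the square `b` through the given pair, so exactly two
  -- transversal triples contain it.
  have htr : ∀ f : Bool → ZMod v × ZMod v × Bool, (∀ b, (f b).2.2 = b) →
      ∀ p : ZMod v × ZMod v × Bool → Prop, ∀ [DecidablePred p], (∀ x, p x ↔ x = f x.2.2) →
      ∑ x, (if p x then 1 else 0) = 2 := by
    intro f hf p _ hp
    rw [← card_filter]
    have : univ.filter p = univ.image f := by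
      ext x
      simp only [mem_filter, mem_univ, true_and, mem_image, hp]
      constructor
      · intro h; exact ⟨_, h.symm⟩
      · rintro ⟨b, rfl⟩; rw [hf]
    rw [this, card_image_of_injective _ fun a b hab => by rw [← hf a, hab, hf]]
    rfl
  have key : ∀ x y : Fin 3 × ZMod v, x ≠ y → x.1 ≤ y.1 →
      #{B | x ∈ triplePts pts e B ∧ y ∈ triplePts pts e B} = 2 := by
    rintro ⟨i, p⟩ ⟨j, q⟩ hne hij
    rw [card_filter, Fintype.sum_sum_type, Fintype.sum_prod_type]
    simp only [mem_triplePts_inl]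
    by_cases hij' : i = j
    · subst hij'
      have hpq : p ≠ q := fun h => hne (by rw [h])
      have h2 := h ((e i).symm p) ((e i).symm q) fun h => hpq ((e i).symm.injective h)
      rw [card_filter] at h2
      rw [sum_eq_single i, sum_eq_zero (s := (univ : Finset (ZMod v × ZMod v × Bool))), add_zero]
      · simpa using h2
      · rintro ⟨r, c, b⟩ -
        rw [if_neg]
        rintro ⟨h1, h2⟩
        simp only [triplePts, mem_insert, mem_singleton, Prod.mk.injEq] at h1 h2
        apply hpq
        fin_cases i <;> simp_all
      · intro k _ hk
        exact sum_eq_zero fun B _ => if_neg fun h => hk h.1.1.symm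
      · simp
    · rw [sum_eq_zero, zero_add]
      · have hcases : (i = 0 ∧ j = 1) ∨ (i = 0 ∧ j = 2) ∨ (i = 1 ∧ j = 2) := by
          clear hne
          change i ≤ j at hij
          revert i j
          decide
        rcases hcases with ⟨rfl, rfl⟩ | ⟨rfl, rfl⟩ | ⟨rfl, rfl⟩
        · refine htr (fun b => (p, q, b)) (fun _ => rfl) _ ?_
          rintro ⟨r, c, b⟩
          simp [triplePts, eq_comm]
        · refine htr (fun b => (p, q - p - (if b then 1 else 0), b)) (fun _ => rfl) _ ?_
          rintro ⟨r, c, b⟩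
          simp only [triplePts]
          constructor
          · intro h
            simp at h
            rw [h.1, h.2]
            ext <;> simp; abel
          · intro h
            simp at h
            rw [h.1, h.2]
            simp
            abel
        · refine htr (fun b => (q - p - (if b then 1 else 0), p, b)) (fun _ => rfl) _ ?_
          rintro ⟨r, c, b⟩
          simp only [triplePts]
          constructor
          · intro h
            simp at h
            rw [h.1, h.2]
            ext <;> simp; abel
          · intro h
            simp at h
            rw [h.1, h.2]
            simp
            abel
      · intro k _
        exact sum_eq_zero fun B _ => if_neg fun h => hij' (h.1.1.trans h.2.1.symm)
  intro x y hne
  rcases le_total x.1 y.1 with hle | hle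
  · exact key x y hne hle
  · rw [← key y x hne.symm hle]
    simp only [and_comm]

end Tripling

/-! ### The two trades and the blocks they change -/

section Trades

variable {v : ℕ}

theorem ZMod.natCast_ne_natCast_of_lt {m n : ℕ} (hm : m < v) (hn : n < v) (h : m ≠ n) :
    (m : ZMod v) ≠ n := fun h' => h (by
  rw [ZMod.natCast_eq_natCast_iff] at h'
  exact Nat.ModEq.eq_of_lt_of_lt h' hm hn)

/-- The numerals `0, 1, 2, 3` are distinct in `ZMod v`. -/
structure SmallNe (v : ℕ) : Prop where
  h01 : (0 : ZMod v) ≠ 1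
  h02 : (0 : ZMod v) ≠ 2
  h03 : (0 : ZMod v) ≠ 3
  h10 : (1 : ZMod v) ≠ 0
  h12 : (1 : ZMod v) ≠ 2
  h13 : (1 : ZMod v) ≠ 3
  h20 : (2 : ZMod v) ≠ 0
  h21 : (2 : ZMod v) ≠ 1
  h23 : (2 : ZMod v) ≠ 3
  h30 : (3 : ZMod v) ≠ 0
  h31 : (3 : ZMod v) ≠ 1
  h32 : (3 : ZMod v) ≠ 2

theorem smallNe_of_four_le (hv : 4 ≤ v) : SmallNe v := by
  have key : ∀ m n : ℕ, m < 4 → n < 4 → m ≠ n → (m : ZMod v) ≠ n := fun m n hm hn h =>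
    ZMod.natCast_ne_natCast_of_lt (by omega) (by omega) h
  constructor
  · exact_mod_cast key 0 1 (by omega) (by omega) (by omega)
  · exact_mod_cast key 0 2 (by omega) (by omega) (by omega)
  · exact_mod_cast key 0 3 (by omega) (by omega) (by omega)
  · exact_mod_cast key 1 0 (by omega) (by omega) (by omega)
  · exact_mod_cast key 1 2 (by omega) (by omega) (by omega)
  · exact_mod_cast key 1 3 (by omega) (by omega) (by omega)
  · exact_mod_cast key 2 0 (by omega) (by omega) (by omega)
  · exact_mod_cast key 2 1 (by omega) (by omega) (by omega)
  · exact_mod_cast key 2 3 (by omega) (by omega) (by omega)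
  · exact_mod_cast key 3 0 (by omega) (by omega) (by omega)
  · exact_mod_cast key 3 1 (by omega) (by omega) (by omega)
  · exact_mod_cast key 3 2 (by omega) (by omega) (by omega)

variable {α β : Type} [DecidableEq β]

/-- The blocks in which the points `(0, 0)` and `(1, 0)` are interchanged. -/
def firstTrade (v : ℕ) (X : β) : Finset (TripleBlock β v) :=
  {.inl (0, X), .inl (1, X), .inr (2, 0, false), .inr (0, 2, false), .inr (0, 1, false),
    .inr (1, 0, false)}

/-- The blocks in which the points `(2, 2)` and `(0, 0)` are interchanged. -/
def secondTrade (v : ℕ) (X : β) : Finset (TripleBlock β v) :=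
  {.inl (2, X), .inr (0, 2, false), .inr (0, 0, true), .inr (0, 2, true)}

/-- The tripled system after the first trade. -/
def tradedOnce (pts : β → Finset α) (e : Fin 3 → α ≃ ZMod v) (X : β) :
    TripleBlock β v → Finset (Fin 3 × ZMod v) :=
  swapPts (triplePts pts e) (0, 0) (1, 0) (firstTrade v X)

/-- The tripled system after both trades. -/
def tradedPts (pts : β → Finset α) (e : Fin 3 → α ≃ ZMod v) (X : β) :
    TripleBlock β v → Finset (Fin 3 × ZMod v) :=
  swapPts (tradedOnce pts e X) (2, 2) (0, 0) (secondTrade v X)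

variable {pts : β → Finset α} {e : Fin 3 → α ≃ ZMod v} {X : β}

theorem card_tradedPts (h : ∀ B, #(pts B) = 3) (B : TripleBlock β v) :
    #(tradedPts pts e X B) = 3 := by
  rw [tradedPts, card_swapPts, tradedOnce, card_swapPts, card_triplePts h]

/-- The labellings send the block `X` to the three blocks used in the trades. -/
structure TradeLabelling (pts : β → Finset α) (e : Fin 3 → α ≃ ZMod v) (X : β) : Prop where
  pts_zero : triplePts pts e (.inl (0, X)) = {(0, 0), (0, 1), (0, 2)}
  pts_one : triplePts pts e (.inl (1, X)) = {(1, 0), (1, 1), (1, 2)}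
  pts_two : triplePts pts e (.inl (2, X)) = {(2, 1), (2, 2), (2, 3)}

theorem pairBalanced_tradedOnce [NeZero v] [DecidableEq α] [Fintype β] (hs : SmallNe v)
    (hX : TradeLabelling pts e X) (h : PairBalanced pts 2) :
    PairBalanced (tradedOnce pts e X) 2 := by
  obtain ⟨h01, h02, h03, h10, h12, h13, h20, h21, h23, h30, h31, h32⟩ := hs
  refine (pairBalanced_triplePts h).swapPts _ _ _ ?_
  -- Within the trade, `(0, 0)` and `(1, 0)` each occur once with `(0, 1)`, `(0, 2)`, `(1, 1)`, `(1,
  -- 2)`, `(2, 1)`, `(2, 2)`, and with no other point.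
  rintro ⟨j, w⟩ hx hy
  rw [firstTrade]
  repeat rw [sum_insert (by simp [*])]
  simp only [sum_singleton, hX.pts_zero, hX.pts_one]
  simp only [triplePts, mem_insert, mem_singleton, Prod.mk.injEq]
  by_cases hw0 : w = 0 <;> by_cases hw1 : w = 1 <;> by_cases hw2 : w = 2 <;>
    fin_cases j <;> simp_all

/-- This is the only block in both trades, so the second trade needs its intermediate form. -/
theorem tradedOnce_inr_zero_two (hs : SmallNe v) :
    tradedOnce pts e X (.inr (0, 2, false)) = {(1, 0), (1, 2), (2, 2)} := by
  obtain ⟨h01, h02, h03, h10, h12, h13, h20, h21, h23, h30, h31, h32⟩ := hs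
  simp [tradedOnce, swapPts, firstTrade, triplePts, Equiv.swap_apply_def, *]

theorem tradedOnce_of_notMem {B : TripleBlock β v} (h : B ∉ firstTrade v X) :
    tradedOnce pts e X B = triplePts pts e B := by
  simp [tradedOnce, swapPts, h]

theorem tradedPts_of_notMem {B : TripleBlock β v} (h : B ∉ firstTrade v X)
    (h' : B ∉ secondTrade v X) : tradedPts pts e X B = triplePts pts e B := by
  simp [tradedPts, tradedOnce, swapPts, h, h']

theorem pairBalanced_tradedPts [NeZero v] [DecidableEq α] [Fintype β] (hs : SmallNe v)
    (hX : TradeLabelling pts e X) (h : PairBalanced pts 2) :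
    PairBalanced (tradedPts pts e X) 2 := by
  have e1 := tradedOnce_inr_zero_two (pts := pts) (e := e) (X := X) hs
  have e2 : tradedOnce pts e X (.inl (2, X)) = _ :=
    tradedOnce_of_notMem (by simp [firstTrade])
  have e3 : tradedOnce pts e X (.inr (0, 0, true)) = _ :=
    tradedOnce_of_notMem (by simp [firstTrade])
  have e4 : tradedOnce pts e X (.inr (0, 2, true)) = _ :=
    tradedOnce_of_notMem (by simp [firstTrade])
  refine (pairBalanced_tradedOnce hs hX h).swapPts _ _ _ ?_
  obtain ⟨h01, h02, h03, h10, h12, h13, h20, h21, h23, h30, h31, h32⟩ := hs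
  have h3 : (2 + 1 : ZMod v) = 3 := by norm_num
  -- Within the second trade, `(2, 2)` and `(0, 0)` each occur once with `(1, 0)`, `(1, 2)`, `(2,
  -- 1)`, `(2, 3)`, and with no other point.
  rintro ⟨j, w⟩ hx hy
  rw [secondTrade]
  repeat rw [sum_insert (by simp [*])]
  simp only [sum_singleton, e1, e2, e3, e4, hX.pts_two]
  simp only [triplePts, mem_insert, mem_singleton, Prod.mk.injEq, if_true, zero_add, h3]
  clear e1 e2 e3 e4 hX h
  by_cases hw0 : w = 0 <;> by_cases hw1 : w = 1 <;> by_cases hw2 : w = 2 <;>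
    by_cases hw3 : w = 3 <;> fin_cases j <;> simp_all

theorem tradedPts_inl_zero (hs : SmallNe v) (hX : TradeLabelling pts e X) :
    tradedPts pts e X (.inl (0, X)) = {(1, 0), (0, 1), (0, 2)} := by
  obtain ⟨h01, h02, h03, h10, h12, h13, h20, h21, h23, h30, h31, h32⟩ := hs
  simp [tradedPts, tradedOnce, swapPts, firstTrade, secondTrade, hX.pts_zero,
    Equiv.swap_apply_def, *]

theorem tradedPts_inl_one (hs : SmallNe v) (hX : TradeLabelling pts e X) :
    tradedPts pts e X (.inl (1, X)) = {(0, 0), (1, 1), (1, 2)} := by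
  obtain ⟨h01, h02, h03, h10, h12, h13, h20, h21, h23, h30, h31, h32⟩ := hs
  simp [tradedPts, tradedOnce, swapPts, firstTrade, secondTrade, hX.pts_one,
    Equiv.swap_apply_def, *]

theorem tradedPts_inl_two (hs : SmallNe v) (hX : TradeLabelling pts e X) :
    tradedPts pts e X (.inl (2, X)) = {(2, 1), (0, 0), (2, 3)} := by
  obtain ⟨h01, h02, h03, h10, h12, h13, h20, h21, h23, h30, h31, h32⟩ := hs
  simp [tradedPts, tradedOnce, swapPts, firstTrade, secondTrade, hX.pts_two,
    Equiv.swap_apply_def, *]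

theorem tradedPts_two_zero_false (hs : SmallNe v) :
    tradedPts pts e X (.inr (2, 0, false)) = {(0, 2), (0, 0), (2, 2)} := by
  obtain ⟨h01, h02, h03, h10, h12, h13, h20, h21, h23, h30, h31, h32⟩ := hs
  simp [tradedPts, tradedOnce, swapPts, firstTrade, secondTrade, triplePts,
    Equiv.swap_apply_def, *]

theorem tradedPts_zero_two_false (hs : SmallNe v) :
    tradedPts pts e X (.inr (0, 2, false)) = {(1, 0), (1, 2), (0, 0)} := by
  rw [tradedPts, swapPts, tradedOnce_inr_zero_two hs]
  simp [secondTrade, Equiv.swap_apply_def]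

theorem tradedPts_zero_one_false (hs : SmallNe v) :
    tradedPts pts e X (.inr (0, 1, false)) = {(1, 0), (1, 1), (2, 1)} := by
  obtain ⟨h01, h02, h03, h10, h12, h13, h20, h21, h23, h30, h31, h32⟩ := hs
  simp [tradedPts, tradedOnce, swapPts, firstTrade, secondTrade, triplePts,
    Equiv.swap_apply_def, *]

theorem tradedPts_one_zero_false (hs : SmallNe v) :
    tradedPts pts e X (.inr (1, 0, false)) = {(0, 1), (0, 0), (2, 1)} := by
  obtain ⟨h01, h02, h03, h10, h12, h13, h20, h21, h23, h30, h31, h32⟩ := hs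
  simp [tradedPts, tradedOnce, swapPts, firstTrade, secondTrade, triplePts,
    Equiv.swap_apply_def, *]

theorem tradedPts_zero_zero_true (hs : SmallNe v) :
    tradedPts pts e X (.inr (0, 0, true)) = {(2, 2), (1, 0), (2, 1)} := by
  obtain ⟨h01, h02, h03, h10, h12, h13, h20, h21, h23, h30, h31, h32⟩ := hs
  simp [tradedPts, tradedOnce, swapPts, firstTrade, secondTrade, triplePts,
    Equiv.swap_apply_def, *]

theorem tradedPts_zero_two_true (hs : SmallNe v) :
    tradedPts pts e X (.inr (0, 2, true)) = {(2, 2), (1, 2), (2, 3)} := by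
  obtain ⟨h01, h02, h03, h10, h12, h13, h20, h21, h23, h30, h31, h32⟩ := hs
  have h3 : (2 + 1 : ZMod v) = 3 := by norm_num
  simp [tradedPts, tradedOnce, swapPts, firstTrade, secondTrade, triplePts,
    Equiv.swap_apply_def, *]

end Trades

/-! ### Zigzag paths through the rows, and paths in the copies -/

section Cycle

variable {v : ℕ} {α β : Type}

/-- The block of the first Latin square in the cell `(r, c)`. -/
abbrev lowCell (β : Type) {v : ℕ} (r c : ZMod v) : TripleBlock β v := .inr (r, c, false)

/-- The block of the second Latin square in the cell `(r, c)`. -/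
abbrev highCell (β : Type) {v : ℕ} (r c : ZMod v) : TripleBlock β v := .inr (r, c, true)

/-- The low and high cells of row `r`, alternately, from the low cell in column `c` to the low cell
in column `c + n`. -/
def zigzag (β : Type) {v : ℕ} (r : ZMod v) : ZMod v → ℕ → List (TripleBlock β v)
  | c, 0 => [lowCell β r c]
  | c, n + 1 => lowCell β r c :: highCell β r c :: zigzag β r (c + 1) n

theorem length_zigzag (r c : ZMod v) (n : ℕ) : (zigzag β r c n).length = 2 * n + 1 := by
  induction n generalizing c with
  | zero => rfl
  | succ n ih => simp [zigzag, ih]; omega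

theorem lowCell_mem_zigzag (r c : ZMod v) {i n : ℕ} (h : i ≤ n) :
    lowCell β r (c + i) ∈ zigzag β r c n := by
  induction n generalizing c i with
  | zero =>
    obtain rfl : i = 0 := by omega
    simp [zigzag]
  | succ n ih =>
    rcases i with _ | i
    · simp [zigzag]
    · have := ih (c + 1) (i := i) (by omega)
      rw [add_assoc, add_comm 1 (i : ZMod v)] at this
      simp only [zigzag, List.mem_cons]
      right; right
      simpa using this

theorem highCell_mem_zigzag (r c : ZMod v) {i n : ℕ} (h : i < n) :
    highCell β r (c + i) ∈ zigzag β r c n := by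
  induction n generalizing c i with
  | zero => omega
  | succ n ih =>
    rcases i with _ | i
    · simp [zigzag]
    · have := ih (c + 1) (i := i) (by omega)
      rw [add_assoc, add_comm 1 (i : ZMod v)] at this
      simp only [zigzag, List.mem_cons]
      right; right
      simpa using this

theorem natCast_add_sub_eq_zero {k : ℕ} (hk : k ≤ v) :
    (k : ZMod v) + ((v - k : ℕ) : ZMod v) = 0 := by
  rw [← Nat.cast_add, Nat.add_sub_cancel' hk, ZMod.natCast_self]

/-- The zigzag runs from column `k` to column `v`, which is column 0; it therefore ends in the low
cell of column 0 without containing the high cell there. -/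
theorem lowCell_mem_row [NeZero v] {k : ℕ} (hk : k ≤ v) (r w : ZMod v) (hw : w = 0 ∨ k ≤ w.val) :
    lowCell β r w ∈ zigzag β r (k : ZMod v) (v - k) := by
  rcases hw with rfl | hw
  · have := lowCell_mem_zigzag (β := β) r (k : ZMod v) (le_refl (v - k))
    rwa [natCast_add_sub_eq_zero hk] at this
  · have := lowCell_mem_zigzag (β := β) r (k : ZMod v) (i := w.val - k) (n := v - k)
      (by have := w.val_lt; omega)
    rwa [← Nat.cast_add, Nat.add_sub_cancel' hw, ZMod.natCast_zmod_val] at this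

theorem highCell_mem_row [NeZero v] {k : ℕ} (r w : ZMod v) (hw : k ≤ w.val) :
    highCell β r w ∈ zigzag β r (k : ZMod v) (v - k) := by
  have := highCell_mem_zigzag (β := β) r (k : ZMod v) (i := w.val - k) (n := v - k)
    (by have := w.val_lt; omega)
  rwa [← Nat.cast_add, Nat.add_sub_cancel' hw, ZMod.natCast_zmod_val] at this

theorem pathFromTo_zigzag {R : TripleBlock β v → TripleBlock β v → Prop} (r c : ZMod v) (n : ℕ)
    (h : ∀ i < n, R (lowCell β r (c + i)) (highCell β r (c + i)) ∧
      R (highCell β r (c + i)) (lowCell β r (c + i + 1))) :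
    PathFromTo R (zigzag β r c n) (lowCell β r c) (lowCell β r (c + n)) := by
  induction n generalizing c with
  | zero => simpa [zigzag] using PathFromTo.singleton _
  | succ n ih =>
    have h0 := h 0 (by omega)
    simp only [Nat.cast_zero, add_zero] at h0
    have ih' := ih (c + 1) fun i hi => by
      have := h (i + 1) (by omega)
      rw [Nat.cast_add, Nat.cast_one, add_comm (i : ZMod v) 1, ← add_assoc] at this
      exact this
    rw [Nat.cast_add, Nat.cast_one, add_comm (n : ZMod v) 1, ← add_assoc]
    exact PathFromTo.cons h0.1 (PathFromTo.cons h0.2 ih')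

/-- The full row `r`, from the high cell to the low cell in column `0`. -/
def fullRow (β : Type) {v : ℕ} (r : ZMod v) : List (TripleBlock β v) :=
  highCell β r 0 :: zigzag β r ((1 : ℕ) : ZMod v) (v - 1)

/-- The rows from `n + 3` down to `3`. -/
def fullRows (β : Type) (v : ℕ) : ℕ → List (TripleBlock β v)
  | 0 => fullRow β ((3 : ℕ) : ZMod v)
  | n + 1 => fullRow β ((n + 1 + 3 : ℕ) : ZMod v) ++ fullRows β v n

theorem length_fullRows (hv : 1 ≤ v) (n : ℕ) :
    (fullRows β v n).length = (n + 1) * (2 * v) := by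
  have h : ∀ r : ZMod v, (fullRow β r).length = 2 * v := fun r => by
    simp [fullRow, length_zigzag]; omega
  induction n with
  | zero => simp [fullRows, h]
  | succ n ih => rw [fullRows, List.length_append, h, ih]; ring

theorem mem_fullRow [NeZero v] (r w : ZMod v) (b : Bool) :
    (.inr (r, w, b) : TripleBlock β v) ∈ fullRow β r := by
  have hv : 1 ≤ v := NeZero.one_le
  have hw : w = 0 ∨ 1 ≤ w.val := by
    rw [← ZMod.val_eq_zero]; omega
  cases b
  · exact List.mem_cons_of_mem _ (lowCell_mem_row hv r w hw)
  · rcases hw with rfl | hw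
    · simp [fullRow]
    · exact List.mem_cons_of_mem _ (highCell_mem_row r w hw)

theorem mem_fullRows [NeZero v] {m n : ℕ} (h3 : 3 ≤ m) (hm : m ≤ n + 3) (w : ZMod v) (b : Bool) :
    (.inr ((m : ZMod v), w, b) : TripleBlock β v) ∈ fullRows β v n := by
  induction n with
  | zero =>
    obtain rfl : m = 3 := by omega
    exact mem_fullRow _ _ _
  | succ n ih =>
    rw [fullRows, List.mem_append]
    by_cases h : m ≤ n + 3
    · exact .inr (ih h)
    · obtain rfl : m = n + 1 + 3 := by omega
      exact .inl (mem_fullRow _ _ _)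

variable [DecidableEq β] {pts : β → Finset α} {e : Fin 3 → α ≃ ZMod v} {X : β}

theorem tradedPts_lowCell {r c : ZMod v} (h : ¬(r = 2 ∧ c = 0)) (h' : ¬(r = 0 ∧ (c = 1 ∨ c = 2)))
    (h'' : ¬(r = 1 ∧ c = 0)) :
    tradedPts pts e X (lowCell β r c) = {(0, r), (1, c), (2, r + c)} := by
  rw [tradedPts_of_notMem]
  · simp [triplePts]
  · simp [firstTrade]; tauto
  · simp [secondTrade]; tauto

theorem tradedPts_highCell {r c : ZMod v} (h : ¬(r = 0 ∧ (c = 0 ∨ c = 2))) :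
    tradedPts pts e X (highCell β r c) = {(0, r), (1, c), (2, r + c + 1)} := by
  rw [tradedPts_of_notMem]
  · simp [triplePts]
  · simp [firstTrade]
  · simp [secondTrade]; tauto

theorem meetInTwo_lowCell_highCell (hp : ∀ B, #(pts B) = 3) (h10 : (1 : ZMod v) ≠ 0) {r c : ZMod v}
    (hl : tradedPts pts e X (lowCell β r c) = {(0, r), (1, c), (2, r + c)})
    (hh : tradedPts pts e X (highCell β r c) = {(0, r), (1, c), (2, r + c + 1)}) :
    MeetInTwo (tradedPts pts e X) (lowCell β r c) (highCell β r c) :=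
  meetInTwo_of_mem (x := (0, r)) (y := (1, c)) (2, r + c) (card_tradedPts hp _) (by simp)
    (by simp [hl]) (by simp [hl]) (by simp [hh]) (by simp [hh]) (by simp [hl]) (by simp [hh, h10])

theorem meetInTwo_highCell_lowCell (hp : ∀ B, #(pts B) = 3) {r c : ZMod v}
    (hh : tradedPts pts e X (highCell β r c) = {(0, r), (1, c), (2, r + c + 1)})
    (hr : (0, r) ∈ tradedPts pts e X (lowCell β r (c + 1)))
    (hrc : (2, r + c + 1) ∈ tradedPts pts e X (lowCell β r (c + 1)))
    (hc : (1, c) ∉ tradedPts pts e X (lowCell β r (c + 1))) :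
    MeetInTwo (tradedPts pts e X) (highCell β r c) (lowCell β r (c + 1)) :=
  meetInTwo_of_mem (x := (0, r)) (y := (2, r + c + 1)) (1, c) (card_tradedPts hp _) (by simp)
    (by simp [hh]) (by simp [hh]) hr hrc (by simp [hh]) hc

/-- The two cells share their column and the symbol `r + c + 1`; this is the passage between
consecutive rows. -/
theorem meetInTwo_lowCell_highCell_above (hp : ∀ B, #(pts B) = 3) (h10 : (1 : ZMod v) ≠ 0)
    {r c : ZMod v}
    (hl : tradedPts pts e X (lowCell β (r + 1) c) = {(0, r + 1), (1, c), (2, r + 1 + c)})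
    (hh : tradedPts pts e X (highCell β r c) = {(0, r), (1, c), (2, r + c + 1)}) :
    MeetInTwo (tradedPts pts e X) (lowCell β (r + 1) c) (highCell β r c) :=
  meetInTwo_of_mem (x := (1, c)) (y := (2, r + 1 + c)) (0, r + 1) (card_tradedPts hp _) (by simp)
    (by simp [hl]) (by simp [hl]) (by simp [hh]) (by simp [hh]; ring) (by simp [hl])
    (by simp [hh, h10])

/-- The part of row `r` from column `k` to column `v = 0`. -/
theorem pathFromTo_row (hp : ∀ B, #(pts B) = 3) (h10 : (1 : ZMod v) ≠ 0) (r : ZMod v) {k : ℕ}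
    (hk : 1 ≤ k) (hkv : k ≤ v)
    (hl : ∀ m : ℕ, k ≤ m → m < v →
      tradedPts pts e X (lowCell β r m) = {(0, r), (1, (m : ZMod v)), (2, r + m)})
    (hh : ∀ m : ℕ, k ≤ m → m < v →
      tradedPts pts e X (highCell β r m) = {(0, r), (1, (m : ZMod v)), (2, r + m + 1)})
    (h0 : (0, r) ∈ tradedPts pts e X (lowCell β r 0))
    (h0' : (2, r) ∈ tradedPts pts e X (lowCell β r 0))
    (h0'' : ∀ c : ZMod v, c ≠ 0 → (1, c) ∉ tradedPts pts e X (lowCell β r 0)) :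
    PathFromTo (MeetInTwo (tradedPts pts e X)) (zigzag β r (k : ZMod v) (v - k))
      (lowCell β r k) (lowCell β r 0) := by
  rw [← natCast_add_sub_eq_zero hkv]
  refine pathFromTo_zigzag r _ _ fun i hi => ?_
  rw [← Nat.cast_add]
  refine ⟨meetInTwo_lowCell_highCell hp h10 (hl _ (by omega) (by omega))
    (hh _ (by omega) (by omega)), ?_⟩
  have hne : ((k + i : ℕ) : ZMod v) ≠ 0 := by
    have := ZMod.natCast_ne_natCast_of_lt (v := v) (m := k + i) (n := 0) (by omega) (by omega)
      (by omega)
    simpa using this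
  -- At the wrap to column 0 only incidences of the low cell are used, because in rows 1 and 2 that
  -- block has been traded.
  by_cases hlast : k + i + 1 = v
  · have hz : ((k + i : ℕ) : ZMod v) + 1 = 0 := by
      rw [← Nat.cast_add_one, hlast, ZMod.natCast_self]
    refine meetInTwo_highCell_lowCell hp (hh _ (by omega) (by omega)) ?_ ?_ ?_
    · rwa [hz]
    · rwa [add_assoc, hz, add_zero]
    · rw [hz]; exact h0'' _ hne
  · have hl' := hl (k + i + 1) (by omega) (by omega)
    rw [Nat.cast_add_one] at hl'
    refine meetInTwo_highCell_lowCell hp (hh _ (by omega) (by omega)) ?_ ?_ ?_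
    · rw [hl']; simp
    · rw [hl', add_assoc]; simp
    · rw [hl']; simp [h10]

theorem pathFromTo_fullRow (hp : ∀ B, #(pts B) = 3) (hs : SmallNe v) (hv : 4 ≤ v) {m : ℕ}
    (h3 : 3 ≤ m) (hm : m < v) :
    PathFromTo (MeetInTwo (tradedPts pts e X)) (fullRow β (m : ZMod v))
      (highCell β (m : ZMod v) 0) (lowCell β (m : ZMod v) 0) := by
  have hne : ∀ i : ℕ, i < 3 → (m : ZMod v) ≠ i := fun i hi =>
    ZMod.natCast_ne_natCast_of_lt hm (by omega) (by omega)
  have n0 : (m : ZMod v) ≠ 0 := by simpa using hne 0 (by omega)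
  have n1 : (m : ZMod v) ≠ 1 := by simpa using hne 1 (by omega)
  have n2 : (m : ZMod v) ≠ 2 := by simpa using hne 2 (by omega)
  have hl : ∀ c : ZMod v, tradedPts pts e X (lowCell β (m : ZMod v) c) = _ := fun c =>
    tradedPts_lowCell (by tauto) (by tauto) (by tauto)
  have hh : ∀ c : ZMod v, tradedPts pts e X (highCell β (m : ZMod v) c) = _ := fun c =>
    tradedPts_highCell (by tauto)
  refine PathFromTo.cons ?_ (pathFromTo_row hp hs.h10 _ le_rfl (by omega) (fun c _ _ => hl _)
    (fun c _ _ => hh _) (by simp [hl]) (by simp [hl]) (fun c hc => by simp [hl, hc]))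
  have h1 := meetInTwo_highCell_lowCell (r := (m : ZMod v)) (c := 0) hp (hh 0) (X := X) (e := e)
  simp only [zero_add, add_zero, Nat.cast_one] at h1 ⊢
  exact h1 (by simp [hl]) (by simp [hl]) (by simp [hl, hs.h10.symm])

theorem pathFromTo_fullRows (hp : ∀ B, #(pts B) = 3) (hs : SmallNe v) (hv : 4 ≤ v) {n : ℕ}
    (hn : n + 3 < v) :
    PathFromTo (MeetInTwo (tradedPts pts e X)) (fullRows β v n)
      (highCell β ((n + 3 : ℕ) : ZMod v) 0) (lowCell β 3 0) := by
  induction n with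
  | zero => simpa [fullRows] using pathFromTo_fullRow (X := X) (e := e) hp hs hv le_rfl hn
  | succ n ih =>
    refine (pathFromTo_fullRow hp hs hv (by omega) hn).append ?_ (ih (by omega))
    have hne : ∀ m : ℕ, 3 ≤ m → m < v → ∀ i : ℕ, i < 3 → (m : ZMod v) ≠ i := fun m h3 hm i hi =>
      ZMod.natCast_ne_natCast_of_lt hm (by omega) (by omega)
    have n0 : ((n + 3 : ℕ) : ZMod v) ≠ 0 := by
      simpa using hne (n + 3) (by omega) (by omega) 0 (by omega)
    have n1 : ((n + 3 : ℕ) : ZMod v) + 1 ≠ 1 := by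
      simpa using hne (n + 3 + 1) (by omega) (by omega) 1 (by omega)
    have n2 : ((n + 3 : ℕ) : ZMod v) + 1 ≠ 2 := by
      simpa using hne (n + 3 + 1) (by omega) (by omega) 2 (by omega)
    have n3 : ((n + 3 : ℕ) : ZMod v) + 1 ≠ 0 := by
      simpa using hne (n + 3 + 1) (by omega) (by omega) 0 (by omega)
    rw [show n + 1 + 3 = n + 3 + 1 by ring, Nat.cast_add_one (n + 3)]
    exact meetInTwo_lowCell_highCell_above hp hs.h10
      (tradedPts_lowCell (by tauto) (by tauto) (by tauto)) (tradedPts_highCell (by tauto))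

/-- Of the copied blocks only the copies of `X` are traded; the others are injective images, and
intersection sizes survive. -/
theorem meetInTwo_inl {i : Fin 3} {B C : β} [DecidableEq α] (hB : B ≠ X) (hC : C ≠ X)
    (h : MeetInTwo pts B C) :
    MeetInTwo (tradedPts pts e X) (.inl (i, B)) (.inl (i, C)) := by
  refine ⟨fun h' => h.1 (by simpa using h'), ?_⟩
  rw [tradedPts_of_notMem (by simp [firstTrade, hB]) (by simp [secondTrade, hB]),
    tradedPts_of_notMem (by simp [firstTrade, hC]) (by simp [secondTrade, hC])]
  simp only [triplePts]
  rw [← map_inter, card_map]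
  exact h.2

theorem pathFromTo_inl [DecidableEq α] {t : List β} {P Q : β} (i : Fin 3)
    (ht : PathFromTo (MeetInTwo pts) t P Q) (hX : ∀ B ∈ t, B ≠ X) :
    PathFromTo (MeetInTwo (tradedPts pts e X)) (t.map fun B => (.inl (i, B) : TripleBlock β v))
      (.inl (i, P)) (.inl (i, Q)) where
  isChain := by
    rw [List.isChain_map]
    exact ht.isChain.imp_of_mem_imp fun B C hB hC h => meetInTwo_inl (hX B hB) (hX C hC) h
  head := by rw [List.head?_map, ht.head]; rfl
  last := by rw [List.getLast?_map, ht.last]; rfl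

end Cycle

/-! ### The Hamilton cycle of the traded system -/

section Main

variable {v : ℕ} {α β : Type}

/-- A Hamilton cycle of the traded system, made from a path `t` through all blocks but `X` of the
system that was tripled. -/
def tradedCycle (v : ℕ) (X : β) (t : List β) : List (TripleBlock β v) :=
  (t.map fun B => .inl (1, B)) ++ [lowCell β 0 2] ++ [.inl (1, X)] ++ [highCell β 0 1] ++
    [lowCell β 1 1] ++ [highCell β 1 1] ++ zigzag β 2 ((1 : ℕ) : ZMod v) (v - 1) ++
    (t.map fun B => .inl (0, B)) ++ (zigzag β 1 ((2 : ℕ) : ZMod v) (v - 2)).reverse ++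
    [highCell β 0 2] ++ (t.map fun B => .inl (2, B)) ++ [.inl (2, X)] ++
    zigzag β 0 ((3 : ℕ) : ZMod v) (v - 3) ++ fullRows β v (v - 4) ++ [highCell β 2 0] ++
    [.inl (0, X)] ++ [highCell β 1 0] ++ [highCell β 0 0] ++ [lowCell β 0 1]

theorem length_tradedCycle (hv : 4 ≤ v) (X : β) (t : List β) :
    (tradedCycle v X t).length = 3 * (t.length + 1) + v * (v * 2) := by
  -- Writing `v = 4 + n` removes the truncated subtractions.
  obtain ⟨n, rfl⟩ := Nat.exists_eq_add_of_le hv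
  simp only [tradedCycle, List.length_append, List.length_map, List.length_reverse,
    List.length_singleton, length_zigzag, length_fullRows (by omega : 1 ≤ 4 + n)]
  rw [show 4 + n - 1 = n + 3 by omega, show 4 + n - 2 = n + 2 by omega,
    show 4 + n - 3 = n + 1 by omega, show 4 + n - 4 = n by omega]
  ring

theorem mem_tradedCycle (hv : 4 ≤ v) {X : β} {t : List β} (ht : ∀ B, B ≠ X → B ∈ t)
    (B : TripleBlock β v) : B ∈ tradedCycle v X t := by
  have : NeZero v := ⟨by omega⟩
  rcases B with ⟨i, B⟩ | ⟨r, c, b⟩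
  · by_cases hB : B = X
    · subst hB
      have hi : i = 0 ∨ i = 1 ∨ i = 2 := by revert i; decide
      rcases hi with rfl | rfl | rfl <;> simp [tradedCycle]
    · have hi : i = 0 ∨ i = 1 ∨ i = 2 := by revert i; decide
      rcases hi with rfl | rfl | rfl <;> simp [tradedCycle, ht B hB]
  · have hsmall : ∀ w : ZMod v, w = 0 ∨ w = 1 ∨ w = 2 ∨ 3 ≤ w.val := by
      intro w
      by_cases h : 3 ≤ w.val
      · simp [h]
      · have hw := ZMod.natCast_zmod_val w
        have : w.val = 0 ∨ w.val = 1 ∨ w.val = 2 := by omega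
        rcases this with h | h | h <;> rw [h] at hw <;> simp [← hw]
    have v0 : (0 : ZMod v).val = 0 := ZMod.val_zero
    have v1 : (1 : ZMod v).val = 1 := by
      have := ZMod.val_natCast_of_lt (n := v) (a := 1) (by omega)
      simpa using this
    have v2 : (2 : ZMod v).val = 2 := by
      have := ZMod.val_natCast_of_lt (n := v) (a := 2) (by omega)
      simpa using this
    -- The zigzags of rows 0, 1, 2 start in columns 3, 2, 1; the cells they miss are single entries
    -- of the cycle. All later rows are full.
    rcases hsmall r with rfl | rfl | rfl | hr
    · have hl := fun h => lowCell_mem_row (β := β) (k := 3) (by omega : 3 ≤ v) 0 c h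
      have hh := fun h => highCell_mem_row (β := β) (k := 3) 0 c h
      simp only [tradedCycle, List.mem_append, List.mem_singleton]
      cases b <;> rcases hsmall c with rfl | rfl | rfl | hc <;> simp_all
    · have hl := fun h => lowCell_mem_row (β := β) (k := 2) (by omega : 2 ≤ v) 1 c h
      have hh := fun h => highCell_mem_row (β := β) (k := 2) 1 c h
      have hle : 3 ≤ c.val → 2 ≤ c.val := fun h => by omega
      simp only [tradedCycle, List.mem_append, List.mem_singleton, List.mem_reverse]
      cases b <;> rcases hsmall c with rfl | rfl | rfl | hc <;> simp_all
    · have hl := fun h => lowCell_mem_row (β := β) (k := 1) (by omega : 1 ≤ v) 2 c h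
      have hh := fun h => highCell_mem_row (β := β) (k := 1) 2 c h
      have hle : 3 ≤ c.val → 1 ≤ c.val := fun h => by omega
      simp only [tradedCycle, List.mem_append, List.mem_singleton]
      cases b <;> rcases hsmall c with rfl | rfl | rfl | hc <;> simp_all
    · have h := mem_fullRows (β := β) (n := v - 4) hr (by have := r.val_lt; omega) c b
      rw [ZMod.natCast_zmod_val] at h
      simp only [tradedCycle, List.mem_append]
      tauto

variable [DecidableEq β] {pts : β → Finset α} {e : Fin 3 → α ≃ ZMod v} {X : β}

theorem pathFromTo_row_zero (hv : 4 ≤ v) (hp : ∀ B, #(pts B) = 3) :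
    PathFromTo (MeetInTwo (tradedPts pts e X)) (zigzag β 0 (3 : ZMod v) (v - 3))
      (lowCell β 0 3) (lowCell β 0 0) := by
  have hs := smallNe_of_four_le hv
  have l00 : tradedPts pts e X (lowCell β 0 0) = _ :=
    tradedPts_lowCell (by simp [hs.h02]) (by simp [hs.h01, hs.h02]) (by simp [hs.h01])
  have hc : ∀ m : ℕ, 3 ≤ m → m < v → (m : ZMod v) ≠ 0 ∧ (m : ZMod v) ≠ 1 ∧ (m : ZMod v) ≠ 2 := by
    intro m h3 hm
    have h : ∀ i : ℕ, i < 3 → (m : ZMod v) ≠ i := fun i hi =>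
      ZMod.natCast_ne_natCast_of_lt hm (by omega) (by omega)
    exact ⟨by simpa using h 0 (by omega), by simpa using h 1 (by omega),
      by simpa using h 2 (by omega)⟩
  rw [show (3 : ZMod v) = ((3 : ℕ) : ZMod v) by simp]
  refine pathFromTo_row hp hs.h10 0 (by omega) (by omega) (fun m h3 hm => ?_) (fun m h3 hm => ?_)
    (by simp [l00]) (by simp [l00]) (fun c hc => by simp [l00, hc])
  · obtain ⟨m0, m1, m2⟩ := hc m h3 hm
    exact tradedPts_lowCell (by simp [m0]) (by simp [m1, m2]) (by simp [m0])
  · obtain ⟨m0, m1, m2⟩ := hc m h3 hm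
    exact tradedPts_highCell (by simp [m0, m2])

theorem pathFromTo_row_one (hv : 4 ≤ v) (hp : ∀ B, #(pts B) = 3) :
    PathFromTo (MeetInTwo (tradedPts pts e X)) (zigzag β 1 (2 : ZMod v) (v - 2))
      (lowCell β 1 2) (lowCell β 1 0) := by
  have hs := smallNe_of_four_le hv
  have l10 := tradedPts_one_zero_false (pts := pts) (e := e) (X := X) hs
  rw [show (2 : ZMod v) = ((2 : ℕ) : ZMod v) by simp]
  refine pathFromTo_row hp hs.h10 1 (by omega) (by omega) (fun m h2 hm => ?_) (fun m h2 hm => ?_)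
    (by simp [l10]) (by simp [l10]) (fun c hc => by simp [l10])
  · have m0 : (m : ZMod v) ≠ 0 := by
      simpa using ZMod.natCast_ne_natCast_of_lt (n := 0) hm (by omega) (by omega)
    exact tradedPts_lowCell (by simp [m0]) (by simp [hs.h10]) (by simp [m0])
  · exact tradedPts_highCell (by simp [hs.h10])

theorem pathFromTo_row_two (hv : 4 ≤ v) (hp : ∀ B, #(pts B) = 3) :
    PathFromTo (MeetInTwo (tradedPts pts e X)) (zigzag β 2 (1 : ZMod v) (v - 1))
      (lowCell β 2 1) (lowCell β 2 0) := by
  have hs := smallNe_of_four_le hv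
  have l20 := tradedPts_two_zero_false (pts := pts) (e := e) (X := X) hs
  rw [show (1 : ZMod v) = ((1 : ℕ) : ZMod v) by simp]
  refine pathFromTo_row hp hs.h10 2 (by omega) (by omega) (fun m h1 hm => ?_) (fun m h1 hm => ?_)
    (by simp [l20]) (by simp [l20]) (fun c hc => by simp [l20])
  · have m0 : (m : ZMod v) ≠ 0 := by
      simpa using ZMod.natCast_ne_natCast_of_lt (n := 0) hm (by omega) (by omega)
    exact tradedPts_lowCell (by simp [m0]) (by simp [hs.h20]) (by simp [m0])
  · exact tradedPts_highCell (by simp [hs.h20])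

theorem pathFromTo_tradedCycle [DecidableEq α] (hv : 4 ≤ v) (hp : ∀ B, #(pts B) = 3)
    (hX : TradeLabelling pts e X) {t : List β} {P Q : β}
    (ht : PathFromTo (MeetInTwo pts) t P Q) (htX : ∀ B ∈ t, B ≠ X)
    (hP0 : (e 0).symm 0 ∈ pts P ∧ (e 0).symm 2 ∈ pts P)
    (hQ0 : (e 0).symm 0 ∈ pts Q ∧ (e 0).symm 1 ∈ pts Q)
    (hQ1 : (e 1).symm 0 ∈ pts Q ∧ (e 1).symm 2 ∈ pts Q)
    (hP2 : (e 2).symm 3 ∈ pts P ∧ (e 2).symm 2 ∈ pts P)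
    (hQ2 : (e 2).symm 3 ∈ pts Q ∧ (e 2).symm 1 ∈ pts Q) :
    PathFromTo (MeetInTwo (tradedPts pts e X)) (tradedCycle v X t) (.inl (1, P))
      (lowCell β 0 1) := by
  have hs := smallNe_of_four_le hv
  have hcard := card_tradedPts (e := e) (X := X) hp
  have X0 := tradedPts_inl_zero hs hX
  have X1 := tradedPts_inl_one hs hX
  have X2 := tradedPts_inl_two hs hX
  have l20 := tradedPts_two_zero_false (pts := pts) (e := e) (X := X) hs
  have l02 := tradedPts_zero_two_false (pts := pts) (e := e) (X := X) hs
  have l01 := tradedPts_zero_one_false (pts := pts) (e := e) (X := X) hs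
  have l10 := tradedPts_one_zero_false (pts := pts) (e := e) (X := X) hs
  have h00 := tradedPts_zero_zero_true (pts := pts) (e := e) (X := X) hs
  have h02 := tradedPts_zero_two_true (pts := pts) (e := e) (X := X) hs
  have hPX : P ≠ X := htX P (List.mem_of_mem_head? ht.head)
  have hQX : Q ≠ X := htX Q (List.mem_of_mem_getLast? ht.last)
  have hin : ∀ B : β, B ≠ X → ∀ i j (w : ZMod v),
      (j, w) ∈ tradedPts pts e X (.inl (i, B)) ↔ j = i ∧ (e i).symm w ∈ pts B := by
    intro B hB i j w
    rw [tradedPts_of_notMem (by simp [firstTrade, hB]) (by simp [secondTrade, hB]),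
      mem_triplePts_inl]
  have symm : ∀ B C, MeetInTwo (tradedPts pts e X) B C → MeetInTwo (tradedPts pts e X) C B :=
    fun _ _ h => h.symm
  obtain ⟨n01, n02, n03, n10, n12, n13, n20, n21, n23, n30, n31, n32⟩ := id hs
  have s12 : (1 + 2 : ZMod v) = 3 := by norm_num
  have s21 : (2 + 1 : ZMod v) = 3 := by norm_num
  have s111 : (1 + 1 + 1 : ZMod v) = 3 := by norm_num
  have s11 : (1 + 1 : ZMod v) = 2 := by norm_num
  have h01 : tradedPts pts e X (highCell β 0 1) = _ := tradedPts_highCell (by simp [n10, n12])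
  have h11 : tradedPts pts e X (highCell β 1 1) = _ := tradedPts_highCell (fun h => n10 h.1)
  have h10 : tradedPts pts e X (highCell β 1 0) = _ := tradedPts_highCell (fun h => n10 h.1)
  have h20 : tradedPts pts e X (highCell β 2 0) = _ := tradedPts_highCell (fun h => n20 h.1)
  have l11 : tradedPts pts e X (lowCell β 1 1) = _ :=
    tradedPts_lowCell (fun h => n12 h.1) (fun h => n10 h.1) (fun h => n10 h.2)
  have l21 : tradedPts pts e X (lowCell β 2 1) = _ :=
    tradedPts_lowCell (fun h => n10 h.2) (fun h => n20 h.1) (fun h => n21 h.1)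
  have l12 : tradedPts pts e X (lowCell β 1 2) = _ :=
    tradedPts_lowCell (fun h => n12 h.1) (fun h => n10 h.1) (fun h => n20 h.2)
  have l03 : tradedPts pts e X (lowCell β 0 3) = _ :=
    tradedPts_lowCell (fun h => n02 h.1) (by simp [n31, n32]) (fun h => n01 h.1)
  have l00 : tradedPts pts e X (lowCell β 0 0) = _ :=
    tradedPts_lowCell (fun h => n02 h.1) (by simp [n01, n02]) (fun h => n01 h.1)
  have l30 : tradedPts pts e X (lowCell β 3 0) = _ :=
    tradedPts_lowCell (fun h => n32 h.1) (fun h => n30 h.1) (fun h => n31 h.1)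
  have row0 := pathFromTo_row_zero (e := e) (X := X) hv hp
  have row1 := pathFromTo_row_one (e := e) (X := X) hv hp
  have row2 := pathFromTo_row_two (e := e) (X := X) hv hp
  have rows := pathFromTo_fullRows (X := X) (e := e) hp hs hv (n := v - 4) (by omega)
  rw [tradedCycle, show ((1 : ℕ) : ZMod v) = 1 by simp, show ((2 : ℕ) : ZMod v) = 2 by simp,
    show ((3 : ℕ) : ZMod v) = 3 by simp]
  -- The remaining goals are the junctions in cyclic order. In each, `x` and `y` are the shared
  -- points and the next point is the one missing from the other block.
  refine ((((((((((((((((((pathFromTo_inl 1 ht htX).concat ?_).concat ?_).concat ?_).concat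
    ?_).concat ?_).append ?_ row2).append ?_ (pathFromTo_inl 0 ht htX)).append ?_
    (row1.reverse symm)).concat ?_).append ?_ (pathFromTo_inl 2 ht htX)).concat ?_).append ?_
    row0).append ?_ rows).concat ?_).concat ?_).concat ?_).concat ?_).concat ?_
  · exact (meetInTwo_of_mem (x := (1, 0)) (y := (1, 2)) (0, 0) (hcard _) (by simp [n02])
      (by simp [l02]) (by simp [l02]) (by simp [hin _ hQX, hQ1]) (by simp [hin _ hQX, hQ1])
      (by simp [l02]) (by simp [hin _ hQX])).symm
  · exact meetInTwo_of_mem (x := (0, 0)) (y := (1, 2)) (1, 0) (hcard _) (by simp)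
      (by simp [l02]) (by simp [l02]) (by simp [X1]) (by simp [X1])
      (by simp [l02]) (by simp [X1, n01, n02])
  · exact meetInTwo_of_mem (x := (0, 0)) (y := (1, 1)) (1, 2) (hcard _) (by simp)
      (by simp [X1]) (by simp [X1]) (by simp [h01]) (by simp [h01])
      (by simp [X1]) (by simp [h01, n21])
  · exact meetInTwo_of_mem (x := (1, 1)) (y := (2, 2)) (0, 0) (hcard _) (by simp)
      (by simp [h01]) (by simp [h01, s11]) (by simp [l11]) (by simp [l11, s11])
      (by simp [h01]) (by simp [l11, n01])
  · exact meetInTwo_of_mem (x := (0, 1)) (y := (1, 1)) (2, 2) (hcard _) (by simp)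
      (by simp [l11]) (by simp [l11]) (by simp [h11]) (by simp [h11])
      (by simp [l11, s11]) (by simp [h11, s111, n23])
  · exact meetInTwo_of_mem (x := (1, 1)) (y := (2, 3)) (0, 1) (hcard _) (by simp)
      (by simp [h11]) (by simp [h11, s111]) (by simp [l21]) (by simp [l21, s21])
      (by simp [h11]) (by simp [l21, n12])
  · exact meetInTwo_of_mem (x := (0, 0)) (y := (0, 2)) (2, 2) (hcard _) (by simp [n02])
      (by simp [l20]) (by simp [l20]) (by simp [hin _ hPX, hP0]) (by simp [hin _ hPX, hP0])
      (by simp [l20]) (by simp [hin _ hPX])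
  · exact (meetInTwo_of_mem (x := (0, 0)) (y := (0, 1)) (2, 1) (hcard _) (by simp [n01])
      (by simp [l10]) (by simp [l10]) (by simp [hin _ hQX, hQ0]) (by simp [hin _ hQX, hQ0])
      (by simp [l10]) (by simp [hin _ hQX])).symm
  · exact meetInTwo_of_mem (x := (1, 2)) (y := (2, 3)) (0, 1) (hcard _) (by simp)
      (by simp [l12]) (by simp [l12, s12]) (by simp [h02]) (by simp [h02])
      (by simp [l12]) (by simp [h02])
  · exact meetInTwo_of_mem (x := (2, 2)) (y := (2, 3)) (1, 2) (hcard _) (by simp [n23])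
      (by simp [h02]) (by simp [h02]) (by simp [hin _ hPX, hP2]) (by simp [hin _ hPX, hP2])
      (by simp [h02]) (by simp [hin _ hPX])
  · exact (meetInTwo_of_mem (x := (2, 1)) (y := (2, 3)) (0, 0) (hcard _) (by simp [n13])
      (by simp [X2]) (by simp [X2]) (by simp [hin _ hQX, hQ2]) (by simp [hin _ hQX, hQ2])
      (by simp [X2]) (by simp [hin _ hQX])).symm
  · exact meetInTwo_of_mem (x := (0, 0)) (y := (2, 3)) (2, 1) (hcard _) (by simp)
      (by simp [X2]) (by simp [X2]) (by simp [l03]) (by simp [l03])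
      (by simp [X2]) (by simp [l03, n13])
  -- Row 0 lies cyclically above row `v - 1`, so the usual passage in column 0 applies.
  · have hz : ((v - 4 + 3 : ℕ) : ZMod v) + 1 = 0 := by
      rw [← Nat.cast_add_one, show v - 4 + 3 + 1 = v by omega, ZMod.natCast_self]
    have hne : ((v - 4 + 3 : ℕ) : ZMod v) ≠ 0 := by
      simpa using ZMod.natCast_ne_natCast_of_lt (v := v) (m := v - 4 + 3) (n := 0) (by omega)
        (by omega) (by omega)
    have := meetInTwo_lowCell_highCell_above (r := ((v - 4 + 3 : ℕ) : ZMod v)) (c := 0) (e := e)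
      (X := X) hp n10 (by rw [hz]; exact l00) (tradedPts_highCell fun h => hne h.1)
    rwa [hz] at this
  · have := meetInTwo_lowCell_highCell_above (r := (2 : ZMod v)) (c := 0) (e := e)
      (X := X) hp n10 (by rw [s21]; exact l30) h20
    rwa [s21] at this
  · exact meetInTwo_of_mem (x := (0, 2)) (y := (1, 0)) (2, 3) (hcard _) (by simp)
      (by simp [h20]) (by simp [h20]) (by simp [X0]) (by simp [X0])
      (by simp [h20, s21]) (by simp [X0])
  · exact meetInTwo_of_mem (x := (0, 1)) (y := (1, 0)) (0, 2) (hcard _) (by simp)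
      (by simp [X0]) (by simp [X0]) (by simp [h10]) (by simp [h10])
      (by simp [X0]) (by simp [h10, n21])
  · exact meetInTwo_of_mem (x := (1, 0)) (y := (2, 2)) (0, 1) (hcard _) (by simp)
      (by simp [h10]) (by simp [h10, s11]) (by simp [h00]) (by simp [h00])
      (by simp [h10]) (by simp [h00])
  · exact meetInTwo_of_mem (x := (1, 0)) (y := (2, 1)) (2, 2) (hcard _) (by simp)
      (by simp [h00]) (by simp [h00]) (by simp [l01]) (by simp [l01])
      (by simp [h00]) (by simp [l01, n21])

end Main

theorem theorem6p2 (v : ℕ) (hv : 4 ≤ v)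
    (h : ∃ D : TTS v, (D.iBIG 2).IsHamiltonian) :
    ∃ D : TTS (3 * v), (D.iBIG 2).IsHamiltonian := by
  obtain ⟨D, hD⟩ := h
  have : NeZero v := ⟨by omega⟩
  have hs := smallNe_of_four_le hv
  obtain ⟨X, P, Q, t, a, b, c, hab, hac, hbc, hXabc, ht, htX, htlen, hP, hQ⟩ :=
    D.exists_path_of_isHamiltonian hv hD
  have hcard : Fintype.card D.Point = Fintype.card (ZMod v) := by rw [D.card_point, ZMod.card]
  -- The labels make the path ends fit their neighbours. In copy 0, `{a, b}` lies in the low cell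
  -- `(2, 0)` and `{a, c}` in `(1, 0)`; in copy 1, they lie in the low cells `(0, 1)` and `(0, 2)`;
  -- in copy 2, `{a, b}` lies in the high cell `(0, 2)` and `{a, c}` in the traded `X`.
  obtain ⟨e₀, ha0, hb0, hc0⟩ := exists_equiv_of_three hcard hab hac hbc hs.h02 hs.h01 hs.h21
  obtain ⟨e₁, ha1, hb1, hc1⟩ := exists_equiv_of_three hcard hab hac hbc hs.h01 hs.h02 hs.h12
  obtain ⟨e₂, ha2, hb2, hc2⟩ := exists_equiv_of_three hcard hab hac hbc hs.h32 hs.h31 hs.h21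
  let e : Fin 3 → D.Point ≃ ZMod v := ![e₀, e₁, e₂]
  have hX : TradeLabelling D.pts e X := by
    constructor
    · simp only [triplePts, hXabc, map_insert, map_singleton]
      simp [e, ha0, hb0, hc0]
      ext; simp; tauto
    · simp only [triplePts, hXabc, map_insert, map_singleton]
      simp [e, ha1, hb1, hc1]
    · simp only [triplePts, hXabc, map_insert, map_singleton]
      simp [e, ha2, hb2, hc2]
      ext; simp; tauto
  have hbal : PairBalanced D.pts 2 := D.card_pair
  let E : TTS (3 * v) :=
    { Point := Fin 3 × ZMod v
      Block := TripleBlock D.Block v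
      pts := tradedPts D.pts e X
      card_point := by simp [ZMod.card]
      card_pts := card_tradedPts D.card_pts
      card_pair := pairBalanced_tradedPts hs hX hbal }
  have hpath : PathFromTo (E.iBIG 2).Adj (tradedCycle v X t) (.inl (1, P)) (lowCell D.Block 0 1) :=
    pathFromTo_tradedCycle hv D.card_pts hX ht (fun B hB => (htX B).2 hB)
      ⟨by simpa [e, ← ha0] using hP.1, by simpa [e, ← hb0] using hP.2⟩
      ⟨by simpa [e, ← ha0] using hQ.1, by simpa [e, ← hc0] using hQ.2⟩
      ⟨by simpa [e, ← ha1] using hQ.1, by simpa [e, ← hc1] using hQ.2⟩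
      ⟨by simpa [e, ← ha2] using hP.1, by simpa [e, ← hb2] using hP.2⟩
      ⟨by simpa [e, ← ha2] using hQ.1, by simpa [e, ← hc2] using hQ.2⟩
  have hlen := length_tradedCycle (v := v) hv X t
  refine ⟨E, SimpleGraph.isHamiltonian_of_pathFromTo hpath ?_
    (mem_tradedCycle hv fun B hB => (htX B).1 hB) ?_ (by rw [hlen]; omega)⟩
  -- The cycle closes because the last block and the first block of copy 1 share `(1, 0)` and `(1,
  -- 1)`, the images of `a` and `b`.
  · have l01 := tradedPts_zero_one_false (pts := D.pts) (e := e) (X := X) hs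
    have hPX : P ≠ X := (htX P).2 (List.mem_of_mem_head? ht.head)
    have hPpts : tradedPts D.pts e X (.inl (1, P)) = triplePts D.pts e (.inl (1, P)) :=
      tradedPts_of_notMem (by simp [firstTrade, hPX]) (by simp [secondTrade, hPX])
    refine meetInTwo_of_mem (pts := tradedPts D.pts e X) (x := (1, 0)) (y := (1, 1)) (2, 1)
      (card_tradedPts D.card_pts _) (by simp [hs.h01]) (by simp [l01]) (by simp [l01]) ?_ ?_
      (by simp [l01]) ?_
    · rw [hPpts, mem_triplePts_inl]
      exact ⟨rfl, by simpa [e, ← ha1] using hP.1⟩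
    · rw [hPpts, mem_triplePts_inl]
      exact ⟨rfl, by simpa [e, ← hb1] using hP.2⟩
    · rw [hPpts, mem_triplePts_inl]
      simp
  · rw [hlen, htlen]
    change _ = Fintype.card ((Fin 3 × D.Block) ⊕ (ZMod v × ZMod v × Bool))
    simp [ZMod.card]
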